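/- Let $R$ be a ring with unity. For a right (resp. left) $R$-module $X$, let $X^*=\operatorname{Hom}_R(X,R)$, a left (resp. right) $R$-module through the bimodule ${}_RR_R$. A module is called stable if it has no nonzero projective direct summand. Let $M$ be a finitely presented right $R$-module, let $$P_1\xrightarrow{\,f\,}P_0\xrightarrow{\,g\,}M\to 0$$ be any exact sequence of right $R$-modules with $P_0,P_1$ finitely generated projective, and let $\operatorname{Tr}(M)=\operatorname{Coker}(f^*\colon P_0^*\to P_1^*)$ be the Auslander-Bridger transpose of $M$ with respect to this presentation, a left $R$-module. Let $\operatorname{pd}$ denote projective dimension, and regard $\operatorname{Ext}^1_R(\operatorname{Tr}(M),R)$ as a right $R$-module through the right multiplications on $R$. (i) $M^*=0$ if and only if $M$ is stable and $\operatorname{pd}(\operatorname{Tr}(M))\le 1$. (ii) If $\operatorname{pd}(\operatorname{Tr}(M))\le 1$, then: (a) $M^*$ is a finitely generated projective left $R$-module; (b) $M^{**}$ is a finitely generated projective right $R$-module; (c) the dual of the right $R$-module $\operatorname{Ext}^1_R(\operatorname{Tr}(M),R)$ is zero, and this module is stable; (d) $M\cong M^{**}\oplus\operatorname{Ext}^1_R(\operatorname{Tr}(M),R)$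 as right $R$-modules, so that $M$ is isomorphic to the direct sum of a projective module and a stable module. -/

import Mathlib

/-! Right `R`-modules are modules over `Rᵐᵒᵖ`, left `R`-modules are modules over `R`. -/

universe u v w

/-- The dual `Hom_R(M, R)` of a right `R`-module `M`.  It is a left `R`-module through
`(r • f) x = r * f x`. -/
abbrev RightDual (R : Type u) (M : Type v) [Ring R] [AddCommGroup M] [Module Rᵐᵒᵖ M] :
    Type (max u v) :=
  M →ₗ[Rᵐᵒᵖ] R

/-- The dual `Hom_R(N, R)` of a left `R`-module `N`.  It is a right `R`-module through
`(f · r) x = f x * r`. -/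
abbrev LeftDual (R : Type u) (N : Type v) [Ring R] [AddCommGroup N] [Module R N] :
    Type (max u v) :=
  N →ₗ[R] R

/-- A module is stable if it has no nonzero projective direct summand. -/
def IsStableModule (A : Type u) (M : Type v) [Ring A] [AddCommGroup M] [Module A M] : Prop :=
  ∀ P N : Submodule A M, IsCompl P N → Module.Projective A P → P = ⊥

section Transpose

variable {R : Type u} [Ring R] {P₁ P₀ : Type w} [AddCommGroup P₁] [Module Rᵐᵒᵖ P₁]
  [AddCommGroup P₀] [Module Rᵐᵒᵖ P₀]

/-- The dual `f^* : P₀^* → P₁^*`, `h ↦ h ∘ f`, of a homomorphism `f : P₁ → P₀` of right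
`R`-modules; it is a homomorphism of left `R`-modules. -/
def RightDual.map (f : P₁ →ₗ[Rᵐᵒᵖ] P₀) : RightDual R P₀ →ₗ[R] RightDual R P₁ where
  toFun h := h.comp f
  map_add' _ _ := rfl
  map_smul' _ _ := rfl

/-- The Auslander-Bridger transpose `Coker (f^*) = P₁^* / Im (f^*)`, a left `R`-module, of the
right `R`-module presented by `f : P₁ → P₀`. -/
abbrev ABTranspose (f : P₁ →ₗ[Rᵐᵒᵖ] P₀) : Type (max u w) :=
  RightDual R P₁ ⧸ LinearMap.range (RightDual.map f)

end Transpose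

section Ext

open CategoryTheory CategoryTheory.Abelian

/-- The regular left `R`-module as an object of the category of left `R`-modules in a universe
that may be larger than that of `R`. -/
abbrev regularModule (R : Type u) [Ring R] : ModuleCat.{max u w} R :=
  ModuleCat.of R (ULift.{w} R)

/-- Right multiplication `x ↦ x * r` as an endomorphism of the regular left `R`-module. -/
def rightMulHom (R : Type u) [Ring R] (r : Rᵐᵒᵖ) :
    regularModule.{u, w} R ⟶ regularModule.{u, w} R :=
  ModuleCat.ofHom
    { toFun := fun x => ULift.up (x.down * r.unop)
      map_add' := fun x y => by ext; simp [add_mul]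
      map_smul' := fun a x => by ext; simp [mul_assoc] }

/-- The group `Ext^1_R(N, R)` of a left `R`-module `N`, for the category of left `R`-modules. -/
def ExtOne (R : Type u) (N : Type (max u w)) [Ring R] [AddCommGroup N] [Module R N] :
    Type (max u w) :=
  Ext.{max u w} (ModuleCat.of.{max u w} R N) (regularModule.{u, w} R) 1

variable (R : Type u) (N : Type (max u w)) [Ring R] [AddCommGroup N] [Module R N]

noncomputable instance : AddCommGroup (ExtOne.{u, w} R N) :=
  inferInstanceAs (AddCommGroup
    (Ext.{max u w} (ModuleCat.of.{max u w} R N) (regularModule.{u, w} R) 1))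

/-- The right `R`-module structure of `Ext^1_R(N, R)`: the element `r` acts by the map
`Ext^1_R(N, R) → Ext^1_R(N, R)` that is induced by `x ↦ x * r`. -/
noncomputable instance : Module Rᵐᵒᵖ (ExtOne.{u, w} R N) where
  smul r e := Ext.comp (Z := regularModule.{u, w} R) e (Ext.mk₀ (rightMulHom.{u, w} R r))
    (add_zero 1)
  one_smul e := by
    have h : rightMulHom.{u, w} R 1 = 𝟙 _ := by ext x; simp [rightMulHom]
    change Ext.comp _ (Ext.mk₀ (rightMulHom.{u, w} R 1)) (add_zero 1) = _
    rw [h]; exact Ext.comp_mk₀_id _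
  mul_smul r s e := by
    have h : rightMulHom.{u, w} R (r * s) = rightMulHom R s ≫ rightMulHom R r := by
      ext x; simp [rightMulHom, mul_assoc]
    change Ext.comp _ (Ext.mk₀ (rightMulHom.{u, w} R (r * s))) (add_zero 1) = _
    rw [h, ← Ext.mk₀_comp_mk₀]
    exact (Ext.comp_assoc_of_third_deg_zero _ _ _ _).symm
  smul_zero r := Ext.zero_comp _ _ _ _ _
  smul_add r e₁ e₂ := Ext.add_comp _ _ _ _
  add_smul r s e := by
    have h : rightMulHom.{u, w} R (r + s) = rightMulHom R r + rightMulHom R s := by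
      ext x; simp [rightMulHom, mul_add]
    change Ext.comp _ (Ext.mk₀ (rightMulHom.{u, w} R (r + s))) (add_zero 1) = _
    rw [h, Ext.mk₀_add]; exact Ext.comp_add _ _ _ _
  zero_smul e := by
    have h : rightMulHom.{u, w} R 0 = 0 := by ext x; simp [rightMulHom]
    change Ext.comp _ (Ext.mk₀ (rightMulHom.{u, w} R 0)) (add_zero 1) = _
    rw [h, Ext.mk₀_zero]; exact Ext.comp_zero _ _ _ _ _

end Ext

/-! Let `I` be the image of `f^*`. Since `Tr M = P₁^* / I` with `P₁^*` projective, `pd (Tr M) ≤ 1`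
means that `I` is projective. The key fact holds without this condition: `Ext^1(Tr M, R)` is the
kernel of `M → M^{**}`, because both are the quotient of `I^*` by the functionals that extend to
`P₁^*` (`RightDual.nonempty_extOne_equiv_ker_eval`). If `I` is projective, then `0 → M^* → P₀^* → I
→ 0` splits, so `M^*` is finitely generated projective and evaluation is onto the projective module
`M^{**}`. Hence `M` is `M^{**}` plus the kernel, whose dual vanishes. For (i), `M^* = 0` makes `f^*`
injective, so `I ≅ P₀^*`; conversely, stability kills the summand `M^{**}`, hence also `M^*`. -/

open MulOpposite

/-! ### Dual bases and reflexivity of finitely generated projective modules. -/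

section Duality

/-- The regular right `R`-module is isomorphic to `Rᵐᵒᵖ` as a left `Rᵐᵒᵖ`-module. -/
def regularRightEquiv (R : Type u) [Ring R] : R ≃ₗ[Rᵐᵒᵖ] Rᵐᵒᵖ where
  toFun := op
  invFun := unop
  left_inv _ := rfl
  right_inv _ := rfl
  map_add' _ _ := rfl
  map_smul' _ _ := rfl

theorem Module.exists_dualBasis (A : Type*) (P : Type*) [Ring A] [AddCommGroup P] [Module A P]
    [Module.Finite A P] [Module.Projective A P] :
    ∃ (n : ℕ) (x : Fin n → P) (h : Fin n → P →ₗ[A] A), ∀ y, ∑ i, h i y • x i = y := by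
  obtain ⟨n, p, s, -, -, hps⟩ := Module.Finite.exists_comp_eq_id_of_projective A P
  refine ⟨n, fun i => p (Pi.single i 1), fun i => (LinearMap.proj i).comp s, fun y => ?_⟩
  have h := LinearMap.congr_fun hps y
  simp only [LinearMap.comp_apply, LinearMap.id_apply] at h
  conv_rhs => rw [← h]
  simp only [LinearMap.comp_apply, LinearMap.proj_apply, ← map_smul, ← map_sum]
  congr 1
  ext j
  simp [Finset.sum_apply, Pi.single_apply]

theorem RightDual.exists_dualBasis (R : Type u) (P : Type v) [Ring R] [AddCommGroup P]
    [Module Rᵐᵒᵖ P] [Module.Finite Rᵐᵒᵖ P] [Module.Projective Rᵐᵒᵖ P] :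
    ∃ (n : ℕ) (x : Fin n → P) (h : Fin n → RightDual R P), ∀ y, ∑ i, op (h i y) • x i = y := by
  obtain ⟨n, x, h, hxh⟩ := Module.exists_dualBasis Rᵐᵒᵖ P
  exact ⟨n, x, fun i => (regularRightEquiv R).symm.toLinearMap.comp (h i), hxh⟩

/-- The roles swap on the dual: evaluations at the `x i` are the coordinates and the `h i` the
generators. -/
theorem RightDual.sum_dualBasis {R : Type u} {P : Type v} [Ring R] [AddCommGroup P]
    [Module Rᵐᵒᵖ P] {n : ℕ} {x : Fin n → P} {h : Fin n → RightDual R P}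
    (hxh : ∀ y, ∑ i, op (h i y) • x i = y) (k : RightDual R P) : ∑ i, k (x i) • h i = k := by
  ext y
  conv_rhs => rw [← hxh y]
  simp [LinearMap.sum_apply]

theorem LeftDual.sum_dualBasis {R : Type u} {N : Type v} [Ring R] [AddCommGroup N]
    [Module R N] {n : ℕ} {x : Fin n → N} {h : Fin n → LeftDual R N}
    (hxh : ∀ y, ∑ i, h i y • x i = y) (k : LeftDual R N) : ∑ i, op (k (x i)) • h i = k := by
  ext y
  conv_rhs => rw [← hxh y]
  simp [LinearMap.sum_apply]

theorem RightDual.finite_projective (R : Type u) (P : Type v) [Ring R] [AddCommGroup P]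
    [Module Rᵐᵒᵖ P] [Module.Finite Rᵐᵒᵖ P] [Module.Projective Rᵐᵒᵖ P] :
    Module.Projective R (RightDual R P) ∧ Module.Finite R (RightDual R P) := by
  obtain ⟨n, x, h, hxh⟩ := RightDual.exists_dualBasis R P
  let s : RightDual R P →ₗ[R] (Fin n → R) :=
    { toFun := fun k i => k (x i)
      map_add' := fun _ _ => rfl
      map_smul' := fun _ _ => rfl }
  let p : (Fin n → R) →ₗ[R] RightDual R P := Fintype.linearCombination R h
  have hps : p.comp s = LinearMap.id := LinearMap.ext fun k => by
    simpa [p, s, Fintype.linearCombination_apply] using RightDual.sum_dualBasis hxh k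
  exact ⟨Module.Projective.of_split s p hps,
    Module.Finite.of_surjective p fun k => ⟨s k, LinearMap.congr_fun hps k⟩⟩

theorem LeftDual.finite_projective (R : Type u) (N : Type v) [Ring R] [AddCommGroup N]
    [Module R N] [Module.Finite R N] [Module.Projective R N] :
    Module.Projective Rᵐᵒᵖ (LeftDual R N) ∧ Module.Finite Rᵐᵒᵖ (LeftDual R N) := by
  obtain ⟨n, x, h, hxh⟩ := Module.exists_dualBasis R N
  let s : LeftDual R N →ₗ[Rᵐᵒᵖ] (Fin n → Rᵐᵒᵖ) :=
    { toFun := fun k i => op (k (x i))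
      map_add' := fun _ _ => rfl
      map_smul' := fun _ _ => rfl }
  let p : (Fin n → Rᵐᵒᵖ) →ₗ[Rᵐᵒᵖ] LeftDual R N := Fintype.linearCombination Rᵐᵒᵖ h
  have hps : p.comp s = LinearMap.id := LinearMap.ext fun k => by
    simpa [p, s, Fintype.linearCombination_apply] using LeftDual.sum_dualBasis hxh k
  exact ⟨Module.Projective.of_split s p hps,
    Module.Finite.of_surjective p fun k => ⟨s k, LinearMap.congr_fun hps k⟩⟩

/-- The evaluation map `M → M^{**}` of a right `R`-module `M`. -/
def RightDual.eval (R : Type u) (M : Type v) [Ring R] [AddCommGroup M] [Module Rᵐᵒᵖ M] :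
    M →ₗ[Rᵐᵒᵖ] LeftDual R (RightDual R M) where
  toFun x :=
    { toFun := fun h => h x
      map_add' := fun _ _ => rfl
      map_smul' := fun _ _ => rfl }
  map_add' _ _ := LinearMap.ext fun h => map_add h _ _
  map_smul' _ _ := LinearMap.ext fun h => map_smul h _ _

@[simp]
theorem RightDual.eval_apply {R : Type u} {M : Type v} [Ring R] [AddCommGroup M] [Module Rᵐᵒᵖ M]
    (x : M) (h : RightDual R M) : RightDual.eval R M x h = h x := rfl

theorem RightDual.eval_bijective (R : Type u) (P : Type v) [Ring R] [AddCommGroup P]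
    [Module Rᵐᵒᵖ P] [Module.Finite Rᵐᵒᵖ P] [Module.Projective Rᵐᵒᵖ P] :
    Function.Bijective (RightDual.eval R P) := by
  obtain ⟨n, x, h, hxh⟩ := RightDual.exists_dualBasis R P
  refine ⟨(injective_iff_map_eq_zero _).2 fun y hy => ?_, fun k => ⟨∑ i, op (k (h i)) • x i, ?_⟩⟩
  · rw [← hxh y]
    refine Finset.sum_eq_zero fun i _ => ?_
    rw [← RightDual.eval_apply y, hy]
    simp
  · ext l
    conv_rhs => rw [← RightDual.sum_dualBasis hxh l]
    simp

theorem LeftDual.subsingleton_of_projective {R : Type u} {N : Type v} [Ring R] [AddCommGroup N]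
    [Module R N] [Module.Finite R N] [Module.Projective R N] [Subsingleton (LeftDual R N)] :
    Subsingleton N := by
  obtain ⟨n, x, h, hxh⟩ := Module.exists_dualBasis R N
  refine subsingleton_of_forall_eq 0 fun y => ?_
  rw [← hxh y]
  exact Finset.sum_eq_zero fun i _ => by rw [Subsingleton.elim (h i) 0]; simp

/-- A module with zero dual is stable. -/
theorem RightDual.isStableModule_of_subsingleton {R : Type u} {M : Type v} [Ring R]
    [AddCommGroup M] [Module Rᵐᵒᵖ M] [Subsingleton (RightDual R M)] : IsStableModule Rᵐᵒᵖ M := by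
  intro P N hPN hP
  obtain ⟨s, hs⟩ := Module.projective_def'.1 hP
  rw [Submodule.eq_bot_iff]
  intro x hx
  have h0 : s ⟨x, hx⟩ = 0 := by
    ext i
    -- Each coordinate of the section `s`, precomposed with the projection onto `P`, is a functional
    -- on `M`.
    have h1 : (regularRightEquiv R).symm.toLinearMap.comp
        ((Finsupp.lapply i).comp (s.comp (P.projectionOnto N hPN))) = 0 :=
      Subsingleton.elim _ _
    have h2 := congrArg op (LinearMap.congr_fun h1 x)
    simpa [regularRightEquiv, Submodule.projectionOnto_apply_left hPN ⟨x, hx⟩] using h2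
  have h3 := LinearMap.congr_fun hs ⟨x, hx⟩
  rw [LinearMap.comp_apply, h0, map_zero] at h3
  exact (congrArg Subtype.val h3).symm

end Duality


/-! ### `Ext^1` and projective dimension of a quotient of a projective module. -/

section ExtOfQuotient

open CategoryTheory CategoryTheory.Abelian

variable {R : Type u} [Ring R] {Q : Type (max u w)} [AddCommGroup Q] [Module R Q]

/-- The short complex `I → Q → Q ⧸ I`. -/
def Submodule.quotientShortComplex (I : Submodule R Q) : ShortComplex (ModuleCat.{max u w} R) :=
  ShortComplex.mk (ModuleCat.ofHom I.subtype) (ModuleCat.ofHom I.mkQ) (by ext x; simp)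

theorem Submodule.quotientShortComplex_shortExact (I : Submodule R Q) :
    (Submodule.quotientShortComplex.{u, w} I).ShortExact where
  exact := by
    rw [ShortComplex.moduleCat_exact_iff]
    intro x hx
    exact ⟨⟨x, (Submodule.Quotient.mk_eq_zero I).1 hx⟩, rfl⟩
  mono_f := (ModuleCat.mono_iff_injective _).2 I.injective_subtype
  epi_g := (ModuleCat.epi_iff_surjective _).2 I.mkQ_surjective

/-- Dimension shift along `I → Q → Q ⧸ I`, whose middle term is projective. -/
theorem Submodule.projectiveDimension_quotient_le_one_iff [Module.Projective R Q]
    (I : Submodule R Q) :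
    projectiveDimension (ModuleCat.of.{max u w} R (Q ⧸ I)) ≤ 1 ↔ Module.Projective R I := by
  have hQ : Projective (ModuleCat.of.{max u w} R Q) :=
    (IsProjective.iff_projective.{max u w} Q).1 inferInstance
  rw [IsProjective.iff_projective.{max u w} I, projective_iff_hasProjectiveDimensionLT_one]
  exact (projectiveDimension_le_iff _ 1).trans
    ((Submodule.quotientShortComplex_shortExact I).hasProjectiveDimensionLT_X₃_iff 0 hQ)

/-- A functional on `N`, as a morphism to the regular module. -/
def LeftDual.toHom {N : Type (max u w)} [AddCommGroup N] [Module R N] (φ : LeftDual R N) :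
    ModuleCat.of.{max u w} R N ⟶ regularModule.{u, w} R :=
  ModuleCat.ofHom (ULift.moduleEquiv.symm.toLinearMap.comp φ)

/-- The class of the extension `I → Q → Q ⧸ I`. -/
noncomputable def Submodule.quotientExtClass (I : Submodule R Q) :
    Ext.{max u w} (ModuleCat.of.{max u w} R (Q ⧸ I)) (ModuleCat.of.{max u w} R I) 1 :=
  (Submodule.quotientShortComplex_shortExact.{u, w} I).extClass

/-- `Ext^1(Q, Y) = 0`, so the connecting map from `Hom(I, Y)` is onto. -/
theorem Submodule.exists_quotientExtClass_comp [Module.Projective R Q] (I : Submodule R Q)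
    {Y : ModuleCat.{max u w} R} (e : Ext.{max u w} (ModuleCat.of.{max u w} R (Q ⧸ I)) Y 1) :
    ∃ k : ModuleCat.of.{max u w} R I ⟶ Y,
      (Submodule.quotientExtClass.{u, w} I).comp (Ext.mk₀ k) (add_zero 1) = e := by
  have hQ : Projective (Submodule.quotientShortComplex.{u, w} I).X₂ :=
    (IsProjective.iff_projective.{max u w} Q).1 inferInstance
  obtain ⟨x, hx⟩ := Ext.contravariant_sequence_exact₃
    (Submodule.quotientShortComplex_shortExact I) Y e (Ext.eq_zero_of_projective _) (add_zero 1)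
  obtain ⟨k, rfl⟩ := Ext.homEquiv₀.symm.surjective x
  exact ⟨k, hx⟩

theorem Submodule.quotientExtClass_comp_eq_zero_iff (I : Submodule R Q)
    {Y : ModuleCat.{max u w} R} (k : ModuleCat.of.{max u w} R I ⟶ Y) :
    (Submodule.quotientExtClass.{u, w} I).comp (Ext.mk₀ k) (add_zero 1) = 0 ↔
      ∃ l : ModuleCat.of.{max u w} R Q ⟶ Y, ModuleCat.ofHom I.subtype ≫ l = k := by
  constructor
  · intro h
    obtain ⟨x, hx⟩ := Ext.contravariant_sequence_exact₁
      (Submodule.quotientShortComplex_shortExact I) Y _ (add_zero 1) h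
    obtain ⟨l, rfl⟩ := Ext.homEquiv₀.symm.surjective x
    exact ⟨l, Ext.homEquiv₀.symm.injective ((Ext.mk₀_comp_mk₀ _ _).symm.trans hx)⟩
  · rintro ⟨l, rfl⟩
    rw [← Ext.mk₀_comp_mk₀]
    exact (Submodule.quotientShortComplex_shortExact I).extClass_comp_assoc _

/-- The connecting homomorphism `I^* → Ext^1_R(Q ⧸ I, R)`. -/
noncomputable def Submodule.dualConnecting (I : Submodule R Q) :
    LeftDual R I →ₗ[Rᵐᵒᵖ] ExtOne.{u, w} R (Q ⧸ I) where
  toFun φ := (Submodule.quotientExtClass.{u, w} I).comp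
    (Ext.mk₀ (LeftDual.toHom.{u, w} φ)) (add_zero 1)
  map_add' φ ψ := by
    have h : LeftDual.toHom.{u, w} (φ + ψ) = LeftDual.toHom φ + LeftDual.toHom ψ := rfl
    rw [h, Ext.mk₀_add]
    exact Ext.comp_add _ _ _ _
  map_smul' r φ := by
    have h : LeftDual.toHom.{u, w} (r • φ) = LeftDual.toHom φ ≫ rightMulHom R r := rfl
    rw [h, ← Ext.mk₀_comp_mk₀]
    exact (Ext.comp_assoc_of_third_deg_zero _ _ _ _).symm

theorem Submodule.dualConnecting_surjective [Module.Projective R Q] (I : Submodule R Q) :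
    Function.Surjective (Submodule.dualConnecting.{u, w} I) := by
  intro e
  obtain ⟨k, hk⟩ := Submodule.exists_quotientExtClass_comp.{u, w} I e
  exact ⟨ULift.moduleEquiv.toLinearMap.comp k.hom, hk⟩

theorem Submodule.dualConnecting_eq_zero_iff (I : Submodule R Q) (φ : LeftDual R I) :
    Submodule.dualConnecting.{u, w} I φ = 0 ↔ ∃ ψ : LeftDual R Q, ψ.comp I.subtype = φ := by
  refine (Submodule.quotientExtClass_comp_eq_zero_iff.{u, w} I (LeftDual.toHom φ)).trans ?_
  constructor
  · rintro ⟨l, hl⟩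
    refine ⟨ULift.moduleEquiv.toLinearMap.comp l.hom, ?_⟩
    ext y
    exact congrArg ULift.down (LinearMap.congr_fun (congrArg ModuleCat.Hom.hom hl) y)
  · rintro ⟨ψ, rfl⟩
    exact ⟨LeftDual.toHom ψ, rfl⟩

end ExtOfQuotient

theorem Function.Exact.exists_leftInverse_of_projective {A K N I : Type*} [Ring A]
    [AddCommGroup K] [Module A K] [AddCommGroup N] [Module A N] [AddCommGroup I] [Module A I]
    [Module.Projective A I] {i : K →ₗ[A] N} {p : N →ₗ[A] I} (h : Function.Exact i p)
    (hi : Function.Injective i) (hp : Function.Surjective p) :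
    ∃ l : N →ₗ[A] K, ∀ k, l (i k) = k := by
  obtain ⟨l, hl⟩ := ((h.split_tfae hi hp).out 0 1).1
    (Module.projective_lifting_property p LinearMap.id hp)
  exact ⟨l, LinearMap.congr_fun hl⟩

/-! ### The kernel and image of evaluation, read off from a presentation. -/

section Presentation

variable {R : Type u} [Ring R] {M : Type v} [AddCommGroup M] [Module Rᵐᵒᵖ M]
  {P₁ P₀ : Type w} [AddCommGroup P₁] [Module Rᵐᵒᵖ P₁] [AddCommGroup P₀] [Module Rᵐᵒᵖ P₀]
  {f : P₁ →ₗ[Rᵐᵒᵖ] P₀} {g : P₀ →ₗ[Rᵐᵒᵖ] M}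

/-- A functional on `P₀` that vanishes on the image of `f` factors through `g`. -/
theorem RightDual.exists_comp_eq (hfg : Function.Exact f g) (hg : Function.Surjective g)
    {h : RightDual R P₀} (hh : RightDual.map f h = 0) : ∃ k : RightDual R M, k.comp g = h := by
  have hker : LinearMap.ker g ≤ LinearMap.ker h := by
    intro x hx
    obtain ⟨y, rfl⟩ := (hfg x).1 hx
    exact LinearMap.congr_fun hh y
  refine ⟨((LinearMap.ker g).liftQ h hker).comp (g.quotKerEquivOfSurjective hg).symm.toLinearMap, ?_⟩
  ext x
  have hx : (g.quotKerEquivOfSurjective hg).symm (g x) = Submodule.Quotient.mk x :=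
    (LinearEquiv.symm_apply_eq _).2 rfl
  simp [hx]

theorem RightDual.map_comp_eq_zero (hfg : Function.Exact f g) (k : RightDual R M) :
    RightDual.map f (k.comp g) = 0 := by
  ext y
  change k (g (f y)) = 0
  rw [hfg.apply_apply_eq_zero, map_zero]

/-- If the image of `f^*` is projective, then `g^* : M^* → P₀^*` is a split injection. -/
theorem RightDual.exists_retraction (hfg : Function.Exact f g) (hg : Function.Surjective g)
    [Module.Projective R (LinearMap.range (RightDual.map f))] :
    ∃ l : RightDual R P₀ →ₗ[R] RightDual R M, ∀ k : RightDual R M, l (k.comp g) = k := by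
  let g' : RightDual R M →ₗ[R] RightDual R P₀ :=
    { toFun := fun k => k.comp g
      map_add' := fun _ _ => rfl
      map_smul' := fun _ _ => rfl }
  have hinj : Function.Injective g' := fun k k' h => by
    ext m
    obtain ⟨x, rfl⟩ := hg m
    exact LinearMap.congr_fun h x
  -- Left exactness of the dual gives `0 → M^* → P₀^* → Im f^* → 0`.
  have hex : Function.Exact g' (RightDual.map f).rangeRestrict := by
    intro h
    constructor
    · intro hh
      exact RightDual.exists_comp_eq hfg hg (congrArg Subtype.val hh)
    · rintro ⟨k, rfl⟩
      exact Subtype.ext (RightDual.map_comp_eq_zero hfg k)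
  have hsurj := (RightDual.map (R := R) f).surjective_rangeRestrict
  exact Function.Exact.exists_leftInverse_of_projective (I := LinearMap.range (RightDual.map f))
    hex hinj hsurj

variable [Module.Finite Rᵐᵒᵖ P₀] [Module.Projective Rᵐᵒᵖ P₀]

theorem RightDual.finite_projective_of_presentation (hfg : Function.Exact f g)
    (hg : Function.Surjective g) [Module.Projective R (LinearMap.range (RightDual.map f))] :
    Module.Projective R (RightDual R M) ∧ Module.Finite R (RightDual R M) := by
  obtain ⟨l, hl⟩ := RightDual.exists_retraction hfg hg
  obtain ⟨_, _⟩ := RightDual.finite_projective R P₀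
  let g' : RightDual R M →ₗ[R] RightDual R P₀ :=
    { toFun := fun k => k.comp g
      map_add' := fun _ _ => rfl
      map_smul' := fun _ _ => rfl }
  exact ⟨Module.Projective.of_split g' l (LinearMap.ext hl),
    Module.Finite.of_surjective l fun k => ⟨_, hl k⟩⟩

/-- The retraction `l` extends `ψ` from `M^*` to `P₀^*`, where reflexivity makes it evaluation at a
point. -/
theorem RightDual.eval_surjective_of_presentation (hfg : Function.Exact f g)
    (hg : Function.Surjective g) [Module.Projective R (LinearMap.range (RightDual.map f))] :
    Function.Surjective (RightDual.eval R M) := by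
  intro ψ
  obtain ⟨l, hl⟩ := RightDual.exists_retraction hfg hg
  obtain ⟨x, hx⟩ := (RightDual.eval_bijective R P₀).2 (ψ.comp l)
  refine ⟨g x, LinearMap.ext fun k => ?_⟩
  have h := LinearMap.congr_fun hx (k.comp g)
  rw [LinearMap.comp_apply, hl] at h
  exact h

/-- The map `(Im f^*)^* → M` that sends `φ` to `g x`, where `x` corresponds to `φ ∘ f^*` under
the isomorphism `P₀ ≃ P₀^{**}`. -/
noncomputable def RightDual.rangeDualTo (f : P₁ →ₗ[Rᵐᵒᵖ] P₀) (g : P₀ →ₗ[Rᵐᵒᵖ] M) :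
    LeftDual R (LinearMap.range (RightDual.map f)) →ₗ[Rᵐᵒᵖ] M :=
  let c : LeftDual R (LinearMap.range (RightDual.map f)) →ₗ[Rᵐᵒᵖ] LeftDual R (RightDual R P₀) :=
    { toFun := fun φ => φ.comp (RightDual.map f).rangeRestrict
      map_add' := fun _ _ => rfl
      map_smul' := fun _ _ => rfl }
  (g.comp (LinearEquiv.ofBijective _ (RightDual.eval_bijective R P₀)).symm.toLinearMap).comp c

theorem RightDual.rangeDualTo_apply {φ : LeftDual R (LinearMap.range (RightDual.map f))} {x : P₀}
    (h : RightDual.eval R P₀ x = φ.comp (RightDual.map f).rangeRestrict) :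
    RightDual.rangeDualTo f g φ = g x :=
  congrArg g ((LinearEquiv.symm_apply_eq
    (LinearEquiv.ofBijective _ (RightDual.eval_bijective R P₀))).2 h.symm)

/-- All functionals on `M` vanish at `g x` exactly when evaluation at `x` kills `ker f^*`, that is,
factors through `Im f^*`. -/
theorem RightDual.range_rangeDualTo (hfg : Function.Exact f g) (hg : Function.Surjective g) :
    LinearMap.range (RightDual.rangeDualTo f g) = LinearMap.ker (RightDual.eval R M) := by
  ext m
  constructor
  · rintro ⟨φ, rfl⟩
    obtain ⟨x, hx⟩ := (RightDual.eval_bijective R P₀).2 (φ.comp (RightDual.map f).rangeRestrict)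
    rw [RightDual.rangeDualTo_apply hx, LinearMap.mem_ker]
    ext k
    have h : (RightDual.map f).rangeRestrict (k.comp g) = 0 :=
      Subtype.ext (RightDual.map_comp_eq_zero hfg k)
    have h' := LinearMap.congr_fun hx (k.comp g)
    rw [LinearMap.comp_apply, h, map_zero] at h'
    exact h'
  · intro hm
    obtain ⟨x, rfl⟩ := hg m
    have hker : LinearMap.ker (RightDual.map f) ≤ LinearMap.ker (RightDual.eval R P₀ x) := by
      intro h hh
      obtain ⟨k, rfl⟩ := RightDual.exists_comp_eq hfg hg hh
      exact LinearMap.congr_fun hm k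
    refine ⟨((LinearMap.ker (RightDual.map f)).liftQ _ hker).comp
      (RightDual.map f).quotKerEquivRange.symm.toLinearMap, RightDual.rangeDualTo_apply ?_⟩
    ext h
    have hx : (RightDual.map f).quotKerEquivRange.symm ((RightDual.map f).rangeRestrict h) =
        Submodule.Quotient.mk h := (LinearEquiv.symm_apply_eq _).2 rfl
    rw [LinearMap.comp_apply, LinearMap.comp_apply, LinearEquiv.coe_coe, hx]
    rfl

variable [Module.Finite Rᵐᵒᵖ P₁] [Module.Projective Rᵐᵒᵖ P₁]

/-- By reflexivity of `P₁`, an extension of `φ` is evaluation at some `y`, and it extends `φ`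
exactly when `x = f y`. -/
theorem RightDual.rangeDualTo_eq_zero_iff (hfg : Function.Exact f g)
    (φ : LeftDual R (LinearMap.range (RightDual.map f))) :
    RightDual.rangeDualTo f g φ = 0 ↔
      ∃ ψ : LeftDual R (RightDual R P₁), ψ.comp (Submodule.subtype _) = φ := by
  obtain ⟨x, hx⟩ := (RightDual.eval_bijective R P₀).2 (φ.comp (RightDual.map f).rangeRestrict)
  rw [RightDual.rangeDualTo_apply hx]
  constructor
  · intro h
    obtain ⟨y, rfl⟩ := (hfg x).1 h
    refine ⟨RightDual.eval R P₁ y, ?_⟩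
    ext ⟨_, k, rfl⟩
    exact LinearMap.congr_fun hx k
  · rintro ⟨ψ, rfl⟩
    obtain ⟨y, rfl⟩ := (RightDual.eval_bijective R P₁).2 ψ
    refine (hfg x).2 ⟨y, (RightDual.eval_bijective R P₀).1 ?_⟩
    rw [hx]
    rfl

/-- `Ext^1_R(Tr M, R)` is the kernel of the evaluation map `M → M^{**}`. -/
theorem RightDual.nonempty_extOne_equiv_ker_eval (hfg : Function.Exact f g)
    (hg : Function.Surjective g) :
    Nonempty (ExtOne.{u, w} R (ABTranspose f) ≃ₗ[Rᵐᵒᵖ] LinearMap.ker (RightDual.eval R M)) := by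
  obtain ⟨_, _⟩ := RightDual.finite_projective R P₁
  let I := LinearMap.range (RightDual.map f)
  have hker : LinearMap.ker (Submodule.dualConnecting.{u, w} I) =
      LinearMap.ker (RightDual.rangeDualTo f g) := by
    ext φ
    exact (Submodule.dualConnecting_eq_zero_iff I φ).trans
      (RightDual.rangeDualTo_eq_zero_iff hfg φ).symm
  exact ⟨((LinearMap.quotKerEquivOfSurjective _
    (Submodule.dualConnecting_surjective I)).symm.trans (Submodule.quotEquivOfEq _ _ hker)).trans
    ((LinearMap.quotKerEquivRange _).trans
      (LinearEquiv.ofEq _ _ (RightDual.range_rangeDualTo hfg hg)))⟩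

end Presentation

/-! ### Consequences of splitting the evaluation map. -/

section EvaluationSplitting

variable {R : Type u} [Ring R] {M : Type v} [AddCommGroup M] [Module Rᵐᵒᵖ M]

/-- A functional `h` on the kernel extends to `h.comp l` on `M`, and every functional on `M`
vanishes on the kernel. -/
theorem RightDual.subsingleton_dual_ker_eval (l : M →ₗ[Rᵐᵒᵖ] LinearMap.ker (RightDual.eval R M))
    (hl : l.comp (Submodule.subtype _) = LinearMap.id) :
    Subsingleton (RightDual R (LinearMap.ker (RightDual.eval R M))) := by
  refine subsingleton_of_forall_eq 0 fun h => LinearMap.ext fun x => ?_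
  have h1 := LinearMap.congr_fun (LinearMap.mem_ker.1 x.2) (h.comp l)
  have h2 : l x = x := LinearMap.congr_fun hl x
  rw [RightDual.eval_apply, LinearMap.comp_apply, h2] at h1
  exact h1

theorem IsStableModule.subsingleton_of_equiv_prod {A : Type*} {M : Type*} {P : Type*} {N : Type*}
    [Ring A] [AddCommGroup M] [Module A M] [AddCommGroup P] [Module A P] [AddCommGroup N]
    [Module A N] [Module.Projective A P] (hM : IsStableModule A M) (e : M ≃ₗ[A] P × N) :
    Subsingleton P := by
  have hc := (Submodule.orderIsoMapComap e.symm).isCompl_iff.1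
    (LinearMap.isCompl_range_inl_inr (R := A) (M := P) (M₂ := N))
  let i : P ≃ₗ[A] Submodule.orderIsoMapComap e.symm (LinearMap.range (LinearMap.inl A P N)) :=
    (LinearEquiv.ofInjective _ LinearMap.inl_injective).trans (e.symm.submoduleMap _)
  have hb := hM _ _ hc (Module.Projective.of_equiv i)
  exact (i.trans (LinearEquiv.ofEq _ _ hb)).toEquiv.subsingleton

end EvaluationSplitting

theorem theorem3p6 {R : Type u} [Ring R]
    {M : Type v} [AddCommGroup M] [Module Rᵐᵒᵖ M] [Module.FinitePresentation Rᵐᵒᵖ M]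
    {P₁ P₀ : Type w}
    [AddCommGroup P₁] [Module Rᵐᵒᵖ P₁] [Module.Finite Rᵐᵒᵖ P₁] [Module.Projective Rᵐᵒᵖ P₁]
    [AddCommGroup P₀] [Module Rᵐᵒᵖ P₀] [Module.Finite Rᵐᵒᵖ P₀] [Module.Projective Rᵐᵒᵖ P₀]
    (f : P₁ →ₗ[Rᵐᵒᵖ] P₀) (g : P₀ →ₗ[Rᵐᵒᵖ] M)
    (hfg : Function.Exact f g) (hg : Function.Surjective g) :
    (Subsingleton (RightDual R M) ↔
      IsStableModule Rᵐᵒᵖ M ∧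
        CategoryTheory.projectiveDimension (ModuleCat.of R (ABTranspose f)) ≤ 1) ∧
    (CategoryTheory.projectiveDimension (ModuleCat.of R (ABTranspose f)) ≤ 1 →
      (Module.Projective R (RightDual R M) ∧ Module.Finite R (RightDual R M)) ∧
      (Module.Projective Rᵐᵒᵖ (LeftDual R (RightDual R M)) ∧
        Module.Finite Rᵐᵒᵖ (LeftDual R (RightDual R M))) ∧
      Subsingleton (RightDual R (ExtOne.{u, w} R (ABTranspose f))) ∧
      IsStableModule Rᵐᵒᵖ (ExtOne.{u, w} R (ABTranspose f)) ∧
      Nonempty (M ≃ₗ[Rᵐᵒᵖ]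
        LeftDual R (RightDual R M) × ExtOne.{u, w} R (ABTranspose f))) := by
  obtain ⟨_, _⟩ := RightDual.finite_projective R P₀
  obtain ⟨_, _⟩ := RightDual.finite_projective R P₁
  have hpd : CategoryTheory.projectiveDimension (ModuleCat.of R (ABTranspose f)) ≤ 1 ↔
      Module.Projective R (LinearMap.range (RightDual.map f)) :=
    Submodule.projectiveDimension_quotient_le_one_iff.{u, w} _
  rw [hpd]
  obtain ⟨e⟩ := RightDual.nonempty_extOne_equiv_ker_eval hfg hg
  have main : Module.Projective R (LinearMap.range (RightDual.map f)) →
      (Module.Projective R (RightDual R M) ∧ Module.Finite R (RightDual R M)) ∧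
      (Module.Projective Rᵐᵒᵖ (LeftDual R (RightDual R M)) ∧
        Module.Finite Rᵐᵒᵖ (LeftDual R (RightDual R M))) ∧
      Subsingleton (RightDual R (ExtOne.{u, w} R (ABTranspose f))) ∧
      IsStableModule Rᵐᵒᵖ (ExtOne.{u, w} R (ABTranspose f)) ∧
      Nonempty (M ≃ₗ[Rᵐᵒᵖ]
        LeftDual R (RightDual R M) × ExtOne.{u, w} R (ABTranspose f)) := by
    intro hI
    have h1 := RightDual.finite_projective_of_presentation hfg hg
    have := h1.1
    have := h1.2
    have h2 := LeftDual.finite_projective R (RightDual R M)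
    have := h2.1
    have hsurj := RightDual.eval_surjective_of_presentation hfg hg
    have split := (RightDual.eval R M).exact_subtype_ker_map.split_tfae
      (Submodule.injective_subtype _) hsurj
    have hsec := Module.projective_lifting_property (RightDual.eval R M) LinearMap.id hsurj
    obtain ⟨l, hl⟩ := (split.out 0 1).1 hsec
    obtain ⟨e', -⟩ := (split.out 0 2).1 hsec
    have := RightDual.subsingleton_dual_ker_eval l hl
    have hE : Subsingleton (RightDual R (ExtOne.{u, w} R (ABTranspose f))) := by
      refine ⟨fun h k => LinearMap.ext fun x => ?_⟩
      have hx := LinearMap.congr_fun (Subsingleton.elim (h.comp e.symm.toLinearMap)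
        (k.comp e.symm.toLinearMap)) (e x)
      simpa using hx
    exact ⟨h1, h2, hE, RightDual.isStableModule_of_subsingleton,
      ⟨(e'.trans (LinearEquiv.prodComm _ _ _)).trans
        ((LinearEquiv.refl _ _).prodCongr e.symm)⟩⟩
  refine ⟨⟨fun hM => ⟨RightDual.isStableModule_of_subsingleton, ?_⟩, fun ⟨hM, hI⟩ => ?_⟩, main⟩
  · have hinj : Function.Injective (RightDual.map (R := R) f) :=
      (injective_iff_map_eq_zero _).2 fun h hh => by
        obtain ⟨k, rfl⟩ := RightDual.exists_comp_eq hfg hg hh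
        rw [Subsingleton.elim k 0]
        rfl
    exact Module.Projective.of_equiv (LinearEquiv.ofInjective _ hinj)
  · obtain ⟨⟨_, _⟩, ⟨_, _⟩, -, -, ⟨e'⟩⟩ := main hI
    -- The projective summand `M^{**}` of the stable module `M` is zero.
    have := hM.subsingleton_of_equiv_prod e'
    exact LeftDual.subsingleton_of_projective (R := R)
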